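/- In a $k$-party quantum simultaneous message-passing (SMP) protocol on $n$-bit inputs, each player $\ell\in[k]$ holds $x_\ell\in\{0,1\}^n$ and, knowing only $x_\ell$ (there is no shared randomness and no shared entanglement), sends a quantum state of $q_\ell$ qubits to a referee. The referee does not know the inputs; it measures the joint state it receives and produces an output from the outcome. The communication cost is $\sum_\ell q_\ell$. The protocol has bounded error if on every input the output is correct with probability at least $2/3$. The problem $\mathrm{GroupByEQ}_{k,n}$ asks for the partition of $[k]$ in which $i$ and $j$ lie in a common part if and only if $x_i=x_j$. **Theorem.** There is a universal constant $C>0$ such that the following hold. 1. For all $k$ and all $n\ge 2$ there is a bounded-error quantum SMP protocol for $\mathrm{GroupByEQ}_{k,n}$ with communication cost at most $C\,k\log k\log n$. 2. For all $k$ and all $n\ge 2$, there are bounded-error quantum SMP protocols with communication cost at most $C\,k\log k\log n$ for each of the following problems: (a) $\mathrm{AllEQ}_{k,n}$: decide whether all inputs $x_1,\dots,x_k$ are equal; (b) $\mathrm{ExistsEQ}_{k,n}$: decide whether there are $i\ne j$ with $x_i=x_j$; (c) for any real $p\ge 0$, compute exactly the frequency moment $F_p=\sum_{w\in\{0,1\}^n}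 (f_w)^p$, where $f_w$ is the number of players whose input is $w$ and only the strings $w$ with $f_w>0$ are counted (so that $F_0$ is the number of distinct inputs). 3. For all $k$, there is a bounded-error quantum SMP protocol with communication cost at most $C\,k\log^2 k$ that decides whether a graph $G$ on the node set $[k]$ contains an induced path with two edges ($P_3$), where the player $v$ is given the neighborhood vector $\nu_v\in\{0,1\}^k$ of the node $v$, that is, $\nu_v[u]=1$ if and only if $\{u,v\}$ is an edge of $G$ (the number-in-hand network model). For $k=0$, read $k\log k$ and $k\log^2 k$ as $0$. -/

import Mathlib

/-- The computational basis of a register of `q` qubits: all classical `q`-bit strings. -/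
abbrev QubitBasis (q : ℕ) : Type := Fin q → Bool

/-- A pure state of `q` qubits: a unit vector of `ℂ ^ (2 ^ q)`. -/
structure QubitState (q : ℕ) where
  amp : EuclideanSpace ℂ (QubitBasis q)
  norm_amp : ‖amp‖ = 1

open scoped ComplexOrder in
/-- A quantum simultaneous message-passing protocol with `k` players holding `n`-bit inputs, in
which the referee outputs an element of `S`. There is no shared randomness and no shared
entanglement: player `ℓ`, knowing only its own input, prepares the state of `qubits ℓ` fresh qubits
and sends these to the referee. The referee, who does not know the inputs, performs a quantum
measurement with finitely many outcomes (a POVM `effect`) jointly on all the qubits received, and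
its output is a function of the outcome. -/
structure QuantumSMP (k n : ℕ) (S : Type) where
  /-- The number of qubits sent by each player. -/
  qubits : Fin k → ℕ
  /-- The message of each player, as a function of its own input. -/
  message : (l : Fin k) → (Fin n → Bool) → QubitState (qubits l)
  /-- The number of outcomes of the measurement of the referee. -/
  outcomes : ℕ
  /-- The positive operators of the measurement. A basis vector of the joint register consists of
  a basis vector of the register of each player. -/
  effect : Fin outcomes →
    Matrix ((l : Fin k) → QubitBasis (qubits l)) ((l : Fin k) → QubitBasis (qubits l)) ℂ
  effect_posSemidef : ∀ w, (effect w).PosSemidef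
  effect_sum : ∑ w, effect w = 1
  /-- The output of the referee, as a function of the outcome. -/
  output : Fin outcomes → S

namespace QuantumSMP

variable {k n : ℕ} {S : Type}

/-- The communication cost: the total number of qubits sent by the players. -/
def cost (P : QuantumSMP k n S) : ℕ := ∑ l, P.qubits l

/-- The joint state received by the referee on input `x`: the tensor product of the messages. -/
noncomputable def jointState (P : QuantumSMP k n S) (x : Fin k → Fin n → Bool) :
    ((l : Fin k) → QubitBasis (P.qubits l)) → ℂ :=
  fun b => ∏ l, (P.message l (x l)).amp (b l)

/-- The probability `⟨ψ| M_w |ψ⟩` of the measurement outcome `w` on input `x`. -/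
noncomputable def outcomeProb (P : QuantumSMP k n S) (x : Fin k → Fin n → Bool)
    (w : Fin P.outcomes) : ℝ :=
  (star (P.jointState x) ⬝ᵥ (P.effect w).mulVec (P.jointState x)).re

open Classical in
/-- The probability that on input `x` the output of the referee satisfies `good`. -/
noncomputable def prob (P : QuantumSMP k n S) (x : Fin k → Fin n → Bool) (good : S → Prop) : ℝ :=
  ∑ w with good (P.output w), P.outcomeProb x w

/-- `P` is a bounded-error protocol for the problem in which, on input `x`, the correct outputs are
the `s` with `correct x s`. -/
def Solves (P : QuantumSMP k n S) (correct : (Fin k → Fin n → Bool) → S → Prop) : Prop :=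
  ∀ x : Fin k → Fin n → Bool, 2 / 3 ≤ P.prob x (correct x)

end QuantumSMP

/-- The neighborhood vector of the node `v`. -/
noncomputable def neighborhoodVector {k : ℕ} (G : SimpleGraph (Fin k)) (v : Fin k) :
    Fin k → Bool :=
  open Classical in fun u => decide (G.Adj v u)

/-- `P` is a bounded-error protocol in the number-in-hand network model for the graph problem in
which, on the graph `G`, the correct outputs are the `s` with `correct G s`. The players are the
nodes of `G`, and the input of the player `v` is the neighborhood vector of `v`. -/
def QuantumSMP.SolvesNIH {k : ℕ} {S : Type} (P : QuantumSMP k k S)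
    (correct : SimpleGraph (Fin k) → S → Prop) : Prop :=
  ∀ G : SimpleGraph (Fin k), 2 / 3 ≤ P.prob (neighborhoodVector G) (correct G)

/-- The partition `Q` of the set of players is the correct output of `GroupByEQ` on input `x`: two
players lie in a common part if and only if their inputs are equal. -/
def IsGroupByEQ {k n : ℕ} (x : Fin k → Fin n → Bool)
    (Q : Finpartition (Finset.univ : Finset (Fin k))) : Prop :=
  ∀ i j : Fin k, (∃ t ∈ Q.parts, i ∈ t ∧ j ∈ t) ↔ x i = x j

/-- The bit `b` is the correct output of `AllEQ` on input `x`. -/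
def IsAllEQ {k n : ℕ} (x : Fin k → Fin n → Bool) (b : Bool) : Prop :=
  b = true ↔ ∀ i j : Fin k, x i = x j

/-- The bit `b` is the correct output of `ExistsEQ` on input `x`. -/
def IsExistsEQ {k n : ℕ} (x : Fin k → Fin n → Bool) (b : Bool) : Prop :=
  b = true ↔ ∃ i j : Fin k, i ≠ j ∧ x i = x j

/-- The number of players whose input is `w`. -/
def frequency {k n : ℕ} (x : Fin k → Fin n → Bool) (w : Fin n → Bool) : ℕ :=
  Finset.card {l : Fin k | x l = w}

/-- The `p`-th frequency moment. Only the strings that occur contribute, so that the `0`-th moment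
is the number of distinct inputs. -/
noncomputable def frequencyMoment {k n : ℕ} (p : ℝ) (x : Fin k → Fin n → Bool) : ℝ :=
  ∑ w with frequency x w ≠ 0, (frequency x w : ℝ) ^ p

/-- The bit `b` tells correctly whether `G` contains an induced path with two edges. -/
def IsInducedP3Answer {k : ℕ} (G : SimpleGraph (Fin k)) (b : Bool) : Prop :=
  b = true ↔ Nonempty (SimpleGraph.pathGraph 3 ↪g G)

open Matrix WithLp

/-! All the problems reduce to learning which of at most `2 * k` strings coincide. Each string is
sent as `O(log k)` copies of a fingerprint of `O(log n)` qubits, and fingerprints of distinct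
strings have overlap at most `1 / 2`. For a pair of strings the referee projects every copy onto the
states symmetric under exchanging the two registers (swap test). If the strings agree, this fixes
the state; if not, all copies pass with probability at most `(5 / 8) ^ M`, so the complementary
projection barely moves the state. The same qubits therefore serve for all pairs, one after the
other: the errors add up in norm (`exists_sequential_measurement`), and `O(log k)` copies absorb the
`4 * k ^ 2` tests (`exists_equality_measurement`, `exists_equality_protocol`).

The outputs in parts 1 and 2 depend only on the pattern of equalities (`Solves.exists_of_congr`).
For induced paths, each node encodes its closed neighborhood and the least element of it;
`not_exists_induced_path_iff` reads the answer off the equalities among these strings. -/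

theorem Fintype.sum_prod_apply {ι D R : Type*} [Fintype ι] [DecidableEq ι] [Fintype D]
    [CommSemiring R] (f : ι → D → R) :
    ∑ b : ι → D, ∏ i, f i (b i) = ∏ i, ∑ d, f i d := by
  rw [Finset.prod_univ_sum, Fintype.piFinset_univ]

/-! ### Gentle sequential measurement by projections. -/

section SequentialMeasurement

variable {B : Type*} [Fintype B]

theorem norm_toLp_sq (v : B → ℂ) : ‖toLp 2 v‖ ^ 2 = (star v ⬝ᵥ v).re := by
  rw [EuclideanSpace.norm_sq_eq]
  simp only [dotProduct, Pi.star_apply, Complex.star_def, ← Complex.normSq_eq_conj_mul_self,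
    Complex.normSq_eq_norm_sq, Complex.re_sum, Complex.ofReal_re]

theorem star_dotProduct_conjTranspose_mul_self (A : Matrix B B ℂ) (v : B → ℂ) :
    (star v ⬝ᵥ (Aᴴ * A) *ᵥ v).re = ‖toLp 2 (A *ᵥ v)‖ ^ 2 := by
  rw [norm_toLp_sq, star_mulVec, ← dotProduct_mulVec, mulVec_mulVec]

theorem IsStarProjection.norm_toLp_mulVec_sq {Q : Matrix B B ℂ} (hQ : IsStarProjection Q)
    (v : B → ℂ) : ‖toLp 2 (Q *ᵥ v)‖ ^ 2 = (star v ⬝ᵥ Q *ᵥ v).re := by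
  rw [← star_dotProduct_conjTranspose_mul_self, ← star_eq_conjTranspose, hQ.isSelfAdjoint.star_eq,
    hQ.isIdempotentElem.eq]

variable [DecidableEq B]

open scoped Matrix.Norms.L2Operator in
theorem IsStarProjection.norm_toLp_mulVec_le {Q : Matrix B B ℂ} (hQ : IsStarProjection Q)
    (v : B → ℂ) : ‖toLp 2 (Q *ᵥ v)‖ ≤ ‖toLp 2 v‖ :=
  (l2_opNorm_mulVec Q (toLp 2 v)).trans
    (mul_le_of_le_one_left (norm_nonneg _) hQ.norm_le)

/-- The projection for the outcome `a` of the two-outcome measurement given by `Q`. -/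
def outcomeProjection (Q : Matrix B B ℂ) (a : Bool) : Matrix B B ℂ := if a then Q else 1 - Q

theorem IsStarProjection.outcomeProjection {Q : Matrix B B ℂ} (hQ : IsStarProjection Q)
    (a : Bool) : IsStarProjection (outcomeProjection Q a) := by
  cases a
  · simpa [_root_.outcomeProjection] using hQ.one_sub
  · simpa [_root_.outcomeProjection] using hQ

/-- Measuring projections one after the other: a state that every measurement nearly preserves,
given the outcomes `w`, is nearly preserved by the whole sequence. -/
theorem exists_sequential_measurement (N : ℕ) (Q : Fin N → Matrix B B ℂ)
    (hQ : ∀ t, IsStarProjection (Q t)) :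
    ∃ A : (Fin N → Bool) → Matrix B B ℂ, ∑ w, (A w)ᴴ * A w = 1 ∧
      ∀ (ψ : B → ℂ) (η : ℝ) (w : Fin N → Bool),
        (∀ t, ‖toLp 2 (outcomeProjection (Q t) (w t) *ᵥ ψ - ψ)‖ ≤ η) →
          ‖toLp 2 (A w *ᵥ ψ - ψ)‖ ≤ N * η := by
  induction N with
  | zero => exact ⟨fun _ => 1, by simp, by simp⟩
  | succ N ih =>
    obtain ⟨A, hA, hA'⟩ := ih (fun t => Q t.succ) (fun t => hQ _)
    -- The measurement of `Q 0` comes last, acting on the result of the other `N`.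
    refine ⟨fun w => outcomeProjection (Q 0) (w 0) * A (Fin.tail w), ?_, fun ψ η w h => ?_⟩
    · have hsum : (outcomeProjection (Q 0) true)ᴴ * outcomeProjection (Q 0) true +
          (outcomeProjection (Q 0) false)ᴴ * outcomeProjection (Q 0) false = 1 := by
        simp only [← star_eq_conjTranspose, ((hQ 0).outcomeProjection _).isSelfAdjoint.star_eq,
          ((hQ 0).outcomeProjection _).isIdempotentElem.eq]
        simp [outcomeProjection]
      rw [← (Fin.consEquiv fun _ => Bool).sum_comp, Fintype.sum_prod_type, Finset.sum_comm, ← hA]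
      refine Finset.sum_congr rfl fun w _ => ?_
      have : ∀ X : Matrix B B ℂ, (A w)ᴴ * Xᴴ * (X * A w) = (A w)ᴴ * (Xᴴ * X) * A w := by
        intro X
        simp only [Matrix.mul_assoc]
      simp only [Fin.consEquiv, Equiv.coe_fn_mk, Fin.cons_zero, Fin.tail_cons, conjTranspose_mul,
        Fintype.sum_bool, this]
      rw [← Matrix.add_mul, ← Matrix.mul_add, hsum, Matrix.mul_one]
    · have h0 := h 0
      have h1 := hA' ψ η (Fin.tail w) fun t => h t.succ
      have h2 := ((hQ 0).outcomeProjection (w 0)).norm_toLp_mulVec_le (A (Fin.tail w) *ᵥ ψ - ψ)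
      -- With `R` the last projection, `R A ψ - ψ = R (A ψ - ψ) + (R ψ - ψ)`. Since `R` is a
      -- contraction, the errors add.
      have h3 : toLp 2 ((outcomeProjection (Q 0) (w 0) * A (Fin.tail w)) *ᵥ ψ - ψ) =
          toLp 2 (outcomeProjection (Q 0) (w 0) *ᵥ (A (Fin.tail w) *ᵥ ψ - ψ)) +
          toLp 2 (outcomeProjection (Q 0) (w 0) *ᵥ ψ - ψ) := by
        rw [← toLp_add, mulVec_sub, mulVec_mulVec]
        congr 1
        abel
      rw [h3]
      refine (norm_add_le _ _).trans ?_
      push_cast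
      linarith

end SequentialMeasurement

/-! ### Tensor powers: one test applied to all copies. -/

section TensorPower

variable {B : Type*} [Fintype B] {ι : Type*} [Fintype ι] [DecidableEq ι]

/-- The tensor power of a matrix. -/
def tensorPower (ι : Type*) [Fintype ι] (P : Matrix B B ℂ) : Matrix (ι → B) (ι → B) ℂ :=
  fun b b' => ∏ c, P (b c) (b' c)

theorem tensorPower_mul_self (P : Matrix B B ℂ) :
    tensorPower ι P * tensorPower ι P = tensorPower ι (P * P) := by
  ext b b'
  simp only [tensorPower, mul_apply, ← Finset.prod_mul_distrib]
  exact Fintype.sum_prod_apply fun c d => P (b c) d * P d (b' c)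

theorem tensorPower_mulVec (P : Matrix B B ℂ) (φ : B → ℂ) :
    (tensorPower ι P *ᵥ fun b => ∏ c, φ (b c)) = fun b => ∏ c, (P *ᵥ φ) (b c) := by
  ext b
  simp only [tensorPower, mulVec, dotProduct, ← Finset.prod_mul_distrib]
  exact Fintype.sum_prod_apply fun c d => P (b c) d * φ d

theorem IsStarProjection.tensorPower {P : Matrix B B ℂ} (hP : IsStarProjection P) :
    IsStarProjection (tensorPower ι P) := by
  refine ⟨?_, ?_⟩
  · rw [IsIdempotentElem, tensorPower_mul_self, hP.isIdempotentElem.eq]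
  · have h := hP.isSelfAdjoint.star_eq
    ext b b'
    simp only [star_apply, _root_.tensorPower, star_prod]
    exact Finset.prod_congr rfl fun c _ => by
      rw [← star_apply, h]

theorem star_dotProduct_prod (φ χ : B → ℂ) :
    (star (fun b : ι → B => ∏ c, φ (b c)) ⬝ᵥ fun b => ∏ c, χ (b c)) =
      (star φ ⬝ᵥ χ) ^ Fintype.card ι := by
  simp only [dotProduct, Pi.star_apply, star_prod, ← Finset.prod_mul_distrib]
  rw [Fintype.sum_prod_apply fun (_ : ι) d => star (φ d) * χ d]
  simp

end TensorPower

/-! ### The swap test on a product state. -/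

section SwapTest

variable {V D : Type*} [Fintype V] [DecidableEq V]

/-- A product state whose registers hold the states `φ v`. -/
def productState (φ : V → D → ℂ) : (V → D) → ℂ := fun b => ∏ v, φ v (b v)

theorem productState_comp_swap (φ : V → D → ℂ) (u v : V) (b : V → D) :
    productState φ (b ∘ Equiv.swap u v) = productState (φ ∘ Equiv.swap u v) b := by
  simp only [productState]
  rw [← Equiv.prod_comp (Equiv.swap u v) fun i => (φ ∘ Equiv.swap u v) i (b i)]
  simp

variable [Fintype D]

theorem star_productState_dotProduct (φ χ : V → D → ℂ) :
    star (productState φ) ⬝ᵥ productState χ = ∏ v, star (φ v) ⬝ᵥ χ v := by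
  simp only [dotProduct, productState, Pi.star_apply, star_prod, ← Finset.prod_mul_distrib]
  exact Fintype.sum_prod_apply fun v d => star (φ v d) * χ v d

variable [DecidableEq D]

/-- The projection onto the states that are invariant under exchanging the registers `u` and `v`.
-/
noncomputable def swapTest (u v : V) : Matrix (V → D) (V → D) ℂ :=
  (1 / 2 : ℂ) • (1 + Matrix.of fun b b' => if b' = b ∘ Equiv.swap u v then 1 else 0)

theorem swapTest_mulVec (u v : V) (f : (V → D) → ℂ) :
    (swapTest u v : Matrix (V → D) (V → D) ℂ) *ᵥ f =
      fun b => (f b + f (b ∘ Equiv.swap u v)) / 2 := by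
  ext b
  rw [swapTest, smul_mulVec, add_mulVec, one_mulVec]
  simp only [Pi.smul_apply, Pi.add_apply, smul_eq_mul, mulVec, dotProduct, of_apply, ite_mul,
    one_mul, zero_mul, Finset.sum_ite_eq', Finset.mem_univ, if_true]
  ring

theorem isStarProjection_swapTest (u v : V) :
    IsStarProjection (swapTest u v : Matrix (V → D) (V → D) ℂ) := by
  have hinv : ∀ b : V → D, (b ∘ Equiv.swap u v) ∘ Equiv.swap u v = b := fun b => by
    ext i
    simp
  refine ⟨?_, ?_⟩
  · apply Matrix.toLin'.injective
    ext1 f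
    ext b
    simp only [LinearMap.comp_apply, toLin'_apply, ← mulVec_mulVec, swapTest_mulVec, hinv]
    ring
  · ext b b'
    have : (b = b' ∘ Equiv.swap u v) ↔ (b' = b ∘ Equiv.swap u v) :=
      ⟨fun h => by rw [h, hinv], fun h => by rw [h, hinv]⟩
    have hdiag : b' = b ↔ b = b' := eq_comm
    simp only [swapTest, star_apply, Matrix.smul_apply, Matrix.add_apply, one_apply, of_apply,
      this, hdiag, smul_eq_mul, star_mul', star_add, apply_ite star, star_one, star_zero]
    simp

theorem swapTest_mulVec_productState_of_eq (φ : V → D → ℂ) {u v : V} (h : φ u = φ v) :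
    swapTest u v *ᵥ productState φ = productState φ := by
  have : φ ∘ Equiv.swap u v = φ := by
    ext1 i
    simp only [Function.comp_apply, Equiv.swap_apply_def]
    split_ifs with h1 h2
    · rw [h1, h]
    · rw [h2, h]
    · rfl
  ext b
  simp only [swapTest_mulVec, productState_comp_swap, this]
  ring

/-- The exchanged product state differs from the original only in the registers `u` and `v`, so its
overlap with the original is the overlap of `φ u` and `φ v` times its conjugate. -/
theorem star_productState_dotProduct_swapTest (φ : V → D → ℂ) (hφ : ∀ v, star (φ v) ⬝ᵥ φ v = 1)
    {u v : V} (huv : u ≠ v) :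
    star (productState φ) ⬝ᵥ swapTest u v *ᵥ productState φ =
      ((1 + ‖star (φ u) ⬝ᵥ φ v‖ ^ 2) / 2 : ℝ) := by
  have h1 : swapTest u v *ᵥ productState φ =
      (1 / 2 : ℂ) • (productState φ + productState (φ ∘ Equiv.swap u v)) := by
    ext b
    simp only [swapTest_mulVec, productState_comp_swap]
    simp
    ring
  have h2 : ∏ i, star (φ i) ⬝ᵥ (φ ∘ Equiv.swap u v) i =
      (star (φ u) ⬝ᵥ φ v) * (star (φ v) ⬝ᵥ φ u) := by
    rw [← Finset.prod_subset (Finset.subset_univ {u, v}), Finset.prod_pair huv]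
    · simp
    · intro i _ hi
      simp only [Finset.mem_insert, Finset.mem_singleton, not_or] at hi
      simp [Equiv.swap_apply_of_ne_of_ne hi.1 hi.2, hφ]
  have h3 : star (φ v) ⬝ᵥ φ u = star (star (φ u) ⬝ᵥ φ v) := by
    rw [← star_dotProduct_star, star_star]
  rw [h1, dotProduct_smul, dotProduct_add, star_productState_dotProduct,
    star_productState_dotProduct, h2, h3]
  simp only [hφ, Finset.prod_const_one, smul_eq_mul, Complex.star_def, Complex.mul_conj,
    Complex.normSq_eq_norm_sq]
  push_cast
  ring

end SwapTest

/-! ### Fingerprints from polynomial evaluation codes. -/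

section Fingerprints

open Polynomial in
/-- Distinct polynomials of degree less than `n` agree on at most `n` points. -/
theorem card_agreements_le {F : Type*} [Field F] [Fintype F] [DecidableEq F] {n : ℕ}
    {x y : Fin n → Bool} (hxy : x ≠ y) :
    Finset.card {a : F | ∑ i, (if x i then a ^ (i : ℕ) else 0) =
      ∑ i, (if y i then a ^ (i : ℕ) else 0)} ≤ n := by
  classical
  -- The bits of `x` become coefficients; `0 ≠ 1` in `F`, so distinct strings give distinct
  -- polynomials.
  let p : (Fin n → Bool) → F[X] := fun x => ∑ i : Fin n, C (if x i then 1 else 0) * X ^ (i : ℕ)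
  have heval : ∀ x a, (p x).eval a = ∑ i, (if x i then a ^ (i : ℕ) else 0) := by
    intro x a
    simp only [p, eval_finsetSum, eval_mul, eval_C, eval_pow, eval_X, ite_mul, one_mul, zero_mul]
  have hcoeff : ∀ x (i : Fin n), (p x).coeff i = if x i then 1 else 0 := by
    intro x i
    simp only [p, finsetSum_coeff, coeff_C_mul, coeff_X_pow, Fin.val_inj, mul_ite, mul_one,
      mul_zero, Finset.sum_ite_eq, Finset.mem_univ, if_true]
  have hdeg : ∀ x, (p x).natDegree ≤ n := fun x =>
    natDegree_sum_le_of_forall_le _ _ fun i _ => (natDegree_C_mul_X_pow_le _ _).trans i.2.le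
  have hne : p x - p y ≠ 0 := by
    rw [sub_ne_zero]
    intro h
    apply hxy
    ext i
    have := hcoeff x i
    rw [h, hcoeff] at this
    by_cases hx : x i <;> by_cases hy : y i <;> simp_all
  refine (card_le_degree_of_subset_roots (p := p x - p y) ?_).trans ?_
  · intro a ha
    simp only [Finset.mem_val, Finset.mem_filter, Finset.mem_univ, true_and] at ha
    rw [mem_roots hne, IsRoot, eval_sub, heval, heval, ha, sub_self]
  · exact (natDegree_sub_le _ _).trans (max_le (hdeg x) (hdeg y))

/-- Fingerprints of `n`-bit strings: states of `2 * s` qubits with pairwise overlap at most `1 / 2`.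
-/
theorem exists_fingerprints {n s : ℕ} (hn : 0 < n) (hs : 2 * n ≤ 2 ^ s) :
    ∃ φ : (Fin n → Bool) → QubitBasis (2 * s) → ℂ,
      (∀ x, star (φ x) ⬝ᵥ φ x = 1) ∧ ∀ x y, x ≠ y → ‖star (φ x) ⬝ᵥ φ y‖ ≤ 1 / 2 := by
  classical
  have hs0 : s ≠ 0 := by
    rintro rfl
    simp at hs
    omega
  -- With `2 ^ s` field elements, pairs in `F × F` are labelled exactly by `2 * s` bits.
  let F := GaloisField 2 s
  have : Fintype F := Fintype.ofFinite F
  have hF : Fintype.card F = 2 ^ s := by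
    rw [Fintype.card_eq_nat_card, GaloisField.card 2 s hs0]
  have hcard : Fintype.card (QubitBasis (2 * s)) = Fintype.card (F × F) := by
    simp [QubitBasis, hF, two_mul, pow_add]
  let e : QubitBasis (2 * s) ≃ F × F := Fintype.equivOfCardEq hcard
  let ev : (Fin n → Bool) → F → F := fun x a => ∑ i, (if x i then a ^ (i : ℕ) else 0)
  let c : ℝ := (Real.sqrt (2 ^ s))⁻¹
  have hc : c * c = (2 ^ s)⁻¹ := by
    rw [← mul_inv, Real.mul_self_sqrt (by positivity)]
  -- The uniform superposition over the graph of the evaluation map of `x`; an overlap is the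
  -- fraction of points at which two such maps agree.
  let φ : (Fin n → Bool) → QubitBasis (2 * s) → ℂ :=
    fun x d => if (e d).2 = ev x (e d).1 then (c : ℂ) else 0
  have hover : ∀ x y, star (φ x) ⬝ᵥ φ y =
      ((Finset.card {a : F | ev x a = ev y a} : ℝ) * (2 ^ s)⁻¹ : ℝ) := by
    intro x y
    have h1 : ∀ d, star (φ x d) * φ y d =
        if (e d).2 = ev x (e d).1 ∧ (e d).2 = ev y (e d).1 then (((2 ^ s)⁻¹ : ℝ) : ℂ) else 0 := by
      intro d
      rw [← hc]
      by_cases h1 : (e d).2 = ev x (e d).1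
      · by_cases h2 : (e d).2 = ev y (e d).1
        · simp only [φ, if_pos h1, if_pos h2, if_pos (And.intro h1 h2)]
          simp
        · simp only [φ, if_neg h2, if_neg (fun h => h2 h.2 : ¬(_ ∧ _)), mul_zero]
      · simp only [φ, if_neg h1, if_neg (fun h => h1 h.1 : ¬(_ ∧ _)), star_zero, zero_mul]
    simp only [dotProduct, Pi.star_apply, h1]
    rw [e.sum_comp fun z : F × F => if z.2 = ev x z.1 ∧ z.2 = ev y z.1 then
      (((2 ^ s)⁻¹ : ℝ) : ℂ) else 0, Fintype.sum_prod_type]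
    simp only [ite_and, Finset.sum_ite_eq', Finset.mem_univ, if_true]
    rw [← Finset.sum_filter, Finset.sum_const, nsmul_eq_mul]
    push_cast
    rfl
  refine ⟨φ, fun x => ?_, fun x y hxy => ?_⟩
  · rw [hover]
    simp [hF]
  · rw [hover, Complex.norm_real, Real.norm_of_nonneg (by positivity), ← div_eq_mul_inv,
      div_le_div_iff₀ (by positivity) (by positivity)]
    have h1 : Finset.card {a : F | ev x a = ev y a} ≤ n := card_agreements_le hxy
    have h2 : Finset.card {a : F | ev x a = ev y a} * 2 ≤ 1 * 2 ^ s := by omega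
    exact_mod_cast h2

end Fingerprints

/-! ### Testing all pairs on the same copies. -/

section EqualityMeasurement

/-- There is a measurement that, given `M` copies of states `φ v` for `v : V`, any two of which are
equal or have overlap at most `1 / 2`, finds out which of them are equal. -/
theorem exists_equality_measurement (V D : Type*) [Fintype V] [DecidableEq V] [Fintype D]
    [DecidableEq D] (M : ℕ) :
    ∃ A : (V × V → Bool) → Matrix (Fin M → V → D) (Fin M → V → D) ℂ,
      ∑ w, (A w)ᴴ * A w = 1 ∧
      ∀ φ : V → D → ℂ, (∀ v, star (φ v) ⬝ᵥ φ v = 1) →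
        ∀ w : V × V → Bool, (∀ u v, w (u, v) = true → φ u = φ v) →
        (∀ u v, w (u, v) = false → u ≠ v ∧ ‖star (φ u) ⬝ᵥ φ v‖ ≤ 1 / 2) →
        1 - (Fintype.card V : ℝ) ^ 2 * √((5 / 8) ^ M) ≤
          ‖toLp 2 (A w *ᵥ fun b => ∏ c, productState φ (b c))‖ := by
  let e := Fintype.equivFin (V × V)
  -- All ordered pairs are tested. On the diagonal the test is the identity, and the hypotheses
  -- force `w (u, u) = true`.
  let Q : V × V → Matrix (Fin M → V → D) (Fin M → V → D) ℂ :=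
    fun z => tensorPower (Fin M) (swapTest z.1 z.2)
  have hQ : ∀ z, IsStarProjection (Q z) := fun z => (isStarProjection_swapTest z.1 z.2).tensorPower
  obtain ⟨A, hA, hA'⟩ := exists_sequential_measurement _ (fun t => Q (e.symm t)) fun t => hQ _
  refine ⟨fun w => A (w ∘ e.symm), ?_, fun φ hφ w hw1 hw2 => ?_⟩
  · rw [← hA]
    exact (e.arrowCongr (Equiv.refl Bool)).sum_comp fun w => (A w)ᴴ * A w
  set Ψ : (Fin M → V → D) → ℂ := fun b => ∏ c, productState φ (b c) with hΨ
  have hnorm : ‖toLp 2 Ψ‖ = 1 := by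
    rw [← sq_eq_sq₀ (norm_nonneg _) zero_le_one, norm_toLp_sq, hΨ, star_dotProduct_prod,
      star_productState_dotProduct]
    simp [hφ]
  have hstep : ∀ z, ‖toLp 2 (outcomeProjection (Q z) (w z) *ᵥ Ψ - Ψ)‖ ≤ √((5 / 8) ^ M) := by
    rintro ⟨u, v⟩
    have hQΨ : Q (u, v) *ᵥ Ψ = fun b => ∏ c, (swapTest u v *ᵥ productState φ) (b c) :=
      tensorPower_mulVec _ _
    cases hw : w (u, v)
    · obtain ⟨huv, hover⟩ := hw2 u v hw
      have h1 : outcomeProjection (Q (u, v)) false *ᵥ Ψ - Ψ = -(Q (u, v) *ᵥ Ψ) := by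
        simp [outcomeProjection, sub_mulVec]
      rw [h1, toLp_neg, norm_neg]
      refine Real.le_sqrt_of_sq_le ?_
      rw [(hQ _).norm_toLp_mulVec_sq, hQΨ, hΨ, star_dotProduct_prod,
        star_productState_dotProduct_swapTest φ hφ huv, ← Complex.ofReal_pow, Complex.ofReal_re,
        Fintype.card_fin]
      refine pow_le_pow_left₀ (by positivity) ?_ M
      -- Overlap at most `1 / 2` gives `(1 + 1 / 4) / 2 = 5 / 8`.
      nlinarith [norm_nonneg (star (φ u) ⬝ᵥ φ v)]
    · have h1 : Q (u, v) *ᵥ Ψ = Ψ := by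
        rw [hQΨ, swapTest_mulVec_productState_of_eq φ (hw1 u v hw)]
      simp [outcomeProjection, h1]
  have h := hA' Ψ _ (w ∘ e.symm) fun t => hstep (e.symm t)
  have h2 := norm_sub_norm_le (toLp 2 Ψ) (toLp 2 (A (w ∘ e.symm) *ᵥ Ψ))
  rw [hnorm, norm_sub_rev, ← toLp_sub] at h2
  have hcard : (Fintype.card (V × V) : ℝ) = (Fintype.card V : ℝ) ^ 2 := by
    rw [Fintype.card_prod, Nat.cast_mul, pow_two]
  rw [hcard] at h
  linarith

end EqualityMeasurement

/-! ### From measurements to protocols. -/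

namespace QuantumSMP

variable {k n : ℕ} {S T : Type}

theorem outcomeProb_nonneg (P : QuantumSMP k n S) (x : Fin k → Fin n → Bool)
    (w : Fin P.outcomes) : 0 ≤ P.outcomeProb x w :=
  (P.effect_posSemidef w).re_dotProduct_nonneg _

/-- The protocol `P` with its output processed by `f`. -/
def mapOutput (P : QuantumSMP k n S) (f : S → T) : QuantumSMP k n T where
  __ := P
  output := f ∘ P.output

theorem prob_le_prob_mapOutput (P : QuantumSMP k n S) (f : S → T) (x : Fin k → Fin n → Bool)
    {good : S → Prop} {good' : T → Prop} (h : ∀ s, good s → good' (f s)) :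
    P.prob x good ≤ (P.mapOutput f).prob x good' := by
  classical
  refine Finset.sum_le_sum_of_subset_of_nonneg (fun w hw => ?_)
    fun w _ _ => (P.mapOutput f).outcomeProb_nonneg x w
  rw [Finset.mem_filter] at hw
  exact Finset.mem_filter.2 ⟨Finset.mem_univ _, h _ hw.2⟩

theorem Solves.mapOutput {P : QuantumSMP k n S} {correct : (Fin k → Fin n → Bool) → S → Prop}
    (hP : P.Solves correct) (f : S → T) {correct' : (Fin k → Fin n → Bool) → T → Prop}
    (h : ∀ x s, correct x s → correct' x (f s)) : (P.mapOutput f).Solves correct' :=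
  fun x => (hP x).trans (P.prob_le_prob_mapOutput f x (h x))

-- The operators `(A w)ᴴ * A w` form a POVM, and discarding all outcomes but one only lowers the
-- probability of success. The bijection `e` lets the measurement be designed on registers grouped
-- by copy rather than by player.
open scoped ComplexOrder in
theorem exists_of_measurement (q : ℕ) (amp : Fin k → (Fin n → Bool) → QubitBasis q → ℂ)
    (hamp : ∀ l x, star (amp l x) ⬝ᵥ amp l x = 1) {B Ω : Type*} [Fintype B] [DecidableEq B]
    [Fintype Ω] (e : (Fin k → QubitBasis q) ≃ B) (A : Ω → Matrix B B ℂ)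
    (hA : ∑ w, (A w)ᴴ * A w = 1) (out : Ω → S) :
    ∃ P : QuantumSMP k n S, P.cost = k * q ∧ ∀ x w (good : S → Prop), good (out w) →
      ‖toLp 2 (A w *ᵥ fun b => ∏ l, amp l (x l) (e.symm b l))‖ ^ 2 ≤ P.prob x good := by
  let ω := Fintype.equivFin Ω
  let P : QuantumSMP k n S :=
    { qubits := fun _ => q
      message := fun l x => ⟨toLp 2 (amp l x), by
        rw [← sq_eq_sq₀ (norm_nonneg _) zero_le_one, norm_toLp_sq, hamp]
        simp⟩
      outcomes := Fintype.card Ω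
      effect := fun w => ((A (ω.symm w))ᴴ * A (ω.symm w)).submatrix e e
      effect_posSemidef := fun w => (posSemidef_conjTranspose_mul_self _).submatrix e
      effect_sum := by
        rw [ω.symm.sum_comp fun w => ((A w)ᴴ * A w).submatrix e e]
        rw [← submatrix_one_equiv e, ← hA]
        ext b b'
        simp only [Matrix.sum_apply, submatrix_apply]
      output := fun w => out (ω.symm w) }
  refine ⟨P, by simp [P, cost], fun x w good hw => ?_⟩
  have h : ‖toLp 2 (A w *ᵥ fun b => ∏ l, amp l (x l) (e.symm b l))‖ ^ 2 =
      P.outcomeProb x (ω w) := by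
    rw [← star_dotProduct_conjTranspose_mul_self]
    set Ψ : B → ℂ := fun b => ∏ l, amp l (x l) (e.symm b l)
    have h1 : P.jointState x = Ψ ∘ e := by
      ext b
      simp [jointState, P, Ψ]
    have h2 : P.effect (ω w) = ((A w)ᴴ * A w).submatrix e e := by
      simp [P]
    have h3 : (((A w)ᴴ * A w).submatrix e e) *ᵥ (Ψ ∘ e) = (((A w)ᴴ * A w) *ᵥ Ψ) ∘ e := by
      rw [submatrix_mulVec_equiv]
      simp [Function.comp_assoc]
    change _ = (star (P.jointState x) ⬝ᵥ (P.effect (ω w)).mulVec (P.jointState x)).re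
    rw [h1]
    change _ = (star (Ψ ∘ e) ⬝ᵥ (((A (ω.symm (ω w)))ᴴ * A (ω.symm (ω w))).submatrix e e) *ᵥ
      (Ψ ∘ e)).re
    rw [ω.symm_apply_apply, h3]
    congr 1
    exact (e.sum_comp fun b => star (Ψ b) * (((A w)ᴴ * A w) *ᵥ Ψ) b).symm
  rw [h]
  refine Finset.single_le_sum (fun w _ => P.outcomeProb_nonneg x w) ?_
  simpa [P] using hw

/-- Protocols in which the players send nothing. -/
theorem exists_cost_eq_zero (s : S) : ∃ P : QuantumSMP k n S, P.cost = 0 ∧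
    ∀ x (good : S → Prop), good s → 2 / 3 ≤ P.prob x good := by
  obtain ⟨P, hP, hP'⟩ := exists_of_measurement (k := k) (n := n) 0 (fun _ _ _ => 1)
    (by simp [dotProduct])
    (Equiv.refl _) (fun _ : Unit => 1) (by simp) fun _ => s
  refine ⟨P, by simpa using hP, fun x good hs => le_trans ?_ (hP' x () good hs)⟩
  rw [one_mulVec, norm_toLp_sq]
  simp [dotProduct]
  norm_num

/-- Every player `l` encodes its input in two strings `F l 0 (x l)` and `F l 1 (x l)`. The referee
finds out which of the `2 * k` strings are equal. -/
theorem exists_equality_protocol {n' s t : ℕ} (hn : 0 < n') (hs : 2 * n' ≤ 2 ^ s)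
    (ht : 24 * k ^ 2 ≤ 2 ^ t) (F : Fin k → Fin 2 → (Fin n → Bool) → Fin n' → Bool) :
    ∃ P : QuantumSMP k n ((Fin k × Fin 2) × (Fin k × Fin 2) → Bool),
      P.cost = k * (4 * t * (2 * (2 * s))) ∧
      P.Solves fun x R => ∀ u v, R (u, v) = true ↔ F u.1 u.2 (x u.1) = F v.1 v.2 (x v.1) := by
  obtain ⟨φ, hφ, hφ'⟩ := exists_fingerprints hn hs
  obtain ⟨A, hA, hA'⟩ := exists_equality_measurement (Fin k × Fin 2) (QubitBasis (2 * s)) (4 * t)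
  let i : Fin (4 * t * (2 * (2 * s))) ≃ Fin (4 * t) × Fin 2 × Fin (2 * s) :=
    finProdFinEquiv.symm.trans ((Equiv.refl _).prodCongr finProdFinEquiv.symm)
  let e : (Fin k → QubitBasis (4 * t * (2 * (2 * s)))) ≃
      (Fin (4 * t) → Fin k × Fin 2 → QubitBasis (2 * s)) :=
    { toFun := fun b c v d => b v.1 (i.symm (c, v.2, d))
      invFun := fun b l r => b (i r).1 (l, (i r).2.1) (i r).2.2
      left_inv := fun b => by simp
      right_inv := fun b => by simp }
  let i' : QubitBasis (4 * t * (2 * (2 * s))) ≃ (Fin (4 * t) → Fin 2 → QubitBasis (2 * s)) :=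
    { toFun := fun b c j d => b (i.symm (c, j, d))
      invFun := fun b r => b (i r).1 (i r).2.1 (i r).2.2
      left_inv := fun b => by simp
      right_inv := fun b => by simp }
  let amp : Fin k → (Fin n → Bool) → QubitBasis (4 * t * (2 * (2 * s))) → ℂ :=
    fun l x b => ∏ c, productState (fun j => φ (F l j x)) (i' b c)
  obtain ⟨P, hP, hP'⟩ := exists_of_measurement _ amp
    (fun l x => by
      have := star_dotProduct_prod (ι := Fin (4 * t)) (productState fun j => φ (F l j x))
        (productState fun j => φ (F l j x))
      rw [star_productState_dotProduct] at this
      simp only [hφ, Finset.prod_const_one, one_pow] at this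
      rw [← this]
      exact i'.sum_comp fun b => star (∏ c, productState (fun j => φ (F l j x)) (b c)) *
        ∏ c, productState (fun j => φ (F l j x)) (b c))
    e A hA id
  refine ⟨P, hP, fun x => ?_⟩
  let ψ : Fin k × Fin 2 → QubitBasis (2 * s) → ℂ := fun v => φ (F v.1 v.2 (x v.1))
  let w : (Fin k × Fin 2) × (Fin k × Fin 2) → Bool :=
    fun z => decide (F z.1.1 z.1.2 (x z.1.1) = F z.2.1 z.2.2 (x z.2.1))
  refine le_trans ?_ (hP' x w _ fun u v => by simp [w])
  have hΨ : (fun b => ∏ l, amp l (x l) (e.symm b l)) = fun b => ∏ c, productState ψ (b c) := by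
    ext b
    simp only [amp, productState, Fintype.prod_prod_type]
    rw [Finset.prod_comm]
    simp [ψ, i', e]
  rw [hΨ]
  have h1 := hA' ψ (fun v => hφ _) w (fun u v h => by
    simp only [w, decide_eq_true_eq] at h
    simp only [ψ, h]) (fun u v h => by
    simp only [w, decide_eq_false_iff_not] at h
    exact ⟨fun huv => h (by rw [huv]), hφ' _ _ h⟩)
  -- The square root is `(25 / 64) ^ t`, and `25 / 64 ≤ 1 / 2`.
  have h2 : √((5 / 8 : ℝ) ^ (4 * t)) ≤ (2 ^ t)⁻¹ := by
    rw [show (4 * t) = (2 * t) * 2 by ring, pow_mul _ (2 * t) 2, Real.sqrt_sq (by positivity),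
      pow_mul, ← inv_pow]
    gcongr
    norm_num
  have h3 : (24 * k ^ 2 : ℝ) ≤ 2 ^ t := by exact_mod_cast ht
  have h4 : (Fintype.card (Fin k × Fin 2) : ℝ) ^ 2 * √((5 / 8 : ℝ) ^ (4 * t)) ≤ 1 / 6 := by
    calc _ ≤ (Fintype.card (Fin k × Fin 2) : ℝ) ^ 2 * (2 ^ t)⁻¹ := by gcongr
      _ ≤ 1 / 6 := by
        rw [← div_eq_mul_inv, div_le_div_iff₀ (by positivity) (by norm_num)]
        simp only [Fintype.card_prod, Fintype.card_fin]
        push_cast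
        linarith
  -- The amplitude is at least `5 / 6`, and `(5 / 6) ^ 2 = 25 / 36 ≥ 2 / 3`.
  nlinarith

end QuantumSMP

/-! ### Induced paths and least elements of closed neighborhoods. -/

section InducedPaths

variable {k : ℕ} (G : SimpleGraph (Fin k))

theorem nonempty_pathGraph_three_embedding_iff {V : Type*} (G : SimpleGraph V) :
    Nonempty (SimpleGraph.pathGraph 3 ↪g G) ↔
      ∃ a b c, G.Adj a b ∧ G.Adj b c ∧ a ≠ c ∧ ¬ G.Adj a c := by
  constructor
  · rintro ⟨f⟩
    refine ⟨f 0, f 1, f 2, ?_, ?_, ?_, ?_⟩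
    · rw [f.map_adj_iff, SimpleGraph.pathGraph_adj]
      decide
    · rw [f.map_adj_iff, SimpleGraph.pathGraph_adj]
      decide
    · exact fun h => absurd (f.injective h) (by decide)
    · rw [f.map_adj_iff, SimpleGraph.pathGraph_adj]
      decide
  · rintro ⟨a, b, c, hab, hbc, hac, hac'⟩
    refine ⟨⟨⟨![a, b, c], ?_⟩, ?_⟩⟩
    · intro i j h
      fin_cases i <;> fin_cases j <;>
        simp_all [hab.ne, hab.ne', hbc.ne, hbc.ne', hac.symm]
    · intro i j
      change G.Adj (![a, b, c] i) (![a, b, c] j) ↔ _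
      rw [SimpleGraph.pathGraph_adj]
      fin_cases i <;> fin_cases j <;>
        simp [hab, hab.symm, hbc, hbc.symm, hac', mt SimpleGraph.Adj.symm hac']

/-- A graph contains no induced path with two edges if and only if any two nodes whose closed
neighborhoods have the same least element have the same closed neighborhood. -/
theorem not_exists_induced_path_iff (m : Fin k → Fin k) (hm : ∀ v, m v = v ∨ G.Adj v (m v))
    (hm' : ∀ v u, u = v ∨ G.Adj v u → m v ≤ u) :
    (¬ ∃ a b c, G.Adj a b ∧ G.Adj b c ∧ a ≠ c ∧ ¬ G.Adj a c) ↔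
      ∀ u v, m u = m v → ∀ w, (w = u ∨ G.Adj u w) ↔ (w = v ∨ G.Adj v w) := by
  constructor
  · intro h
    push Not at h
    -- Without an induced path, "equal or adjacent" is an equivalence relation, so nodes sharing a
    -- least neighbor lie in one clique.
    have htrans : ∀ u v w, (u = v ∨ G.Adj u v) → (v = w ∨ G.Adj v w) → (u = w ∨ G.Adj u w) := by
      rintro u v w (rfl | huv) (rfl | hvw)
      · exact Or.inl rfl
      · exact Or.inr hvw
      · exact Or.inr huv
      · by_cases huw : u = w
        · exact Or.inl huw
        · exact Or.inr (h u v w huv hvw huw)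
    have hsymm : ∀ u v, (u = v ∨ G.Adj u v) → (v = u ∨ G.Adj v u) :=
      fun u v h => h.imp Eq.symm SimpleGraph.Adj.symm
    intro u v huv
    have h1 : u = v ∨ G.Adj u v := by
      refine htrans u (m u) v ((hm u).imp Eq.symm id) (hsymm _ _ ?_)
      rw [huv]
      exact (hm v).imp Eq.symm id
    intro w
    have h2 : ∀ a, (w = a ∨ G.Adj a w) ↔ (a = w ∨ G.Adj a w) := fun a => by
      rw [eq_comm]
    rw [h2, h2]
    exact ⟨htrans v u w (hsymm _ _ h1), htrans u v w h1⟩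
  · intro h
    -- Adjacent nodes have the same closed neighborhood, by strong induction on `w`. If `m w < w`,
    -- the claim for `m w` covers both `w` and `u`. If `m w = w`, then `m u < w` would put `m u` in
    -- the closed neighborhood of `w`, against minimality; so the minima agree.
    have key : ∀ w u, G.Adj w u → ∀ z, (z = u ∨ G.Adj u z) ↔ (z = w ∨ G.Adj w z) := by
      intro w
      induction w using WellFoundedLT.induction with
      | ind w ih =>
        intro u hwu
        rcases hm w with hw | hw
        · rcases hm u with hu | hu
          · have h1 := hm' u w (Or.inr hwu.symm)
            have h2 := hm' w u (Or.inr hwu)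
            exact h u w (by rw [hu] at h1 ⊢; rw [hw] at h2 ⊢; exact le_antisymm h1 h2)
          · rcases (hm' u w (Or.inr hwu.symm)).lt_or_eq with hlt | heq
            · have h1 := (ih (m u) hlt u hu.symm w).1 (Or.inr hwu.symm)
              have h2 := hm' w (m u) (h1.imp Eq.symm SimpleGraph.Adj.symm)
              rw [hw] at h2
              exact absurd hlt (not_lt.2 h2)
            · exact h u w (heq.trans hw.symm)
        · have hlt : m w < w := lt_of_le_of_ne (hm' w w (Or.inl rfl)) hw.ne'
          have h1 := ih (m w) hlt w hw.symm
          intro z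
          rcases (h1 u).1 (Or.inr hwu) with rfl | hu
          · exact (h1 z).symm
          · exact (ih (m w) hlt u hu z).trans (h1 z).symm
    rintro ⟨a, b, c, hab, hbc, hac, hac'⟩
    have h1 := (key b c hbc a).2 (Or.inr hab.symm)
    rcases h1 with h1 | h1
    · exact hac h1
    · exact hac' h1.symm

end InducedPaths

/-! ### Outputs determined by the pattern of equalities. -/

section OutputsFromEqualities

variable {k n : ℕ}

theorem exists_isGroupByEQ (x : Fin k → Fin n → Bool) : ∃ Q, IsGroupByEQ x Q := by
  classical
  refine ⟨Finpartition.ofSetoid (Setoid.comap x ⊥), fun i j => ?_⟩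
  constructor
  · rintro ⟨t, ht, hi, hj⟩
    have h1 := Finpartition.mem_part_ofSetoid_iff_rel (s := Setoid.comap x ⊥) (a := i) (b := j)
    rw [← (Finpartition.ofSetoid (Setoid.comap x ⊥)).eq_of_mem_parts ht
      (Finpartition.part_mem _ |>.2 (Finset.mem_univ i)) hi
      (Finpartition.mem_part_self _ |>.2 (Finset.mem_univ i))] at h1
    exact h1.1 hj
  · intro h
    refine ⟨_, Finpartition.part_mem _ |>.2 (Finset.mem_univ i),
      Finpartition.mem_part_self _ |>.2 (Finset.mem_univ i), ?_⟩
    rw [Finpartition.mem_part_ofSetoid_iff_rel]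
    exact h

/-- Each occurring string shares its term equally among the players holding it. The sum over players
visibly depends only on which inputs are equal. -/
theorem frequencyMoment_eq_sum (p : ℝ) (x : Fin k → Fin n → Bool) :
    frequencyMoment p x =
      ∑ l, (frequency x (x l) : ℝ) ^ p / frequency x (x l) := by
  rw [← Finset.sum_fiberwise Finset.univ x, frequencyMoment, Finset.sum_filter]
  refine Finset.sum_congr rfl fun w _ => ?_
  rw [Finset.sum_congr rfl (g := fun _ => (frequency x w : ℝ) ^ p / frequency x w)
    fun l hl => by rw [(Finset.mem_filter.1 hl).2], Finset.sum_const, nsmul_eq_mul]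
  change _ = (frequency x w : ℝ) * _
  split_ifs with h
  · field_simp
  · rw [not_not.1 h]
    simp

theorem frequencyMoment_congr (p : ℝ) {x y : Fin k → Fin n → Bool}
    (h : ∀ i j, x i = x j ↔ y i = y j) : frequencyMoment p x = frequencyMoment p y := by
  have : ∀ l, frequency x (x l) = frequency y (y l) := fun l => by
    simp only [frequency, h]
  simp only [frequencyMoment_eq_sum, this]

end OutputsFromEqualities

/-! ### Cost bounds and the final protocols. -/

theorem Nat.clog_two_le_log {n : ℕ} (hn : 2 ≤ n) : (Nat.clog 2 n : ℝ) ≤ 2 * (Real.log n / Real.log 2) := by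
  have hlog : 0 < Real.log 2 := Real.log_pos (by norm_num)
  have h1 : 2 ^ (Nat.clog 2 n).pred < n := Nat.pow_pred_clog_lt_self (by norm_num) (by omega)
  have h2 : 0 < Nat.clog 2 n := Nat.clog_pos (by norm_num) hn
  have h3 : 2 ^ Nat.clog 2 n ≤ n ^ 2 := by
    calc 2 ^ Nat.clog 2 n = 2 ^ (Nat.clog 2 n).pred * 2 := by
          rw [← pow_succ, ← Nat.succ_eq_add_one, Nat.succ_pred_eq_of_pos h2]
      _ ≤ n * n := by gcongr
      _ = n ^ 2 := by ring
  have h4 : Real.log (2 ^ Nat.clog 2 n) ≤ Real.log (n ^ 2) :=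
    Real.log_le_log (by positivity) (by exact_mod_cast h3)
  rw [Real.log_pow, Real.log_pow] at h4
  rw [← mul_div_assoc, le_div_iff₀ hlog]
  exact_mod_cast h4

namespace QuantumSMP

variable {k n : ℕ} {S : Type}

/-- Knowing only the pattern `R`, the referee picks an answer correct for some input with that
pattern; by `hcongr` it is correct for the actual input too. -/
theorem Solves.exists_of_congr {P : QuantumSMP k n (Fin k → Fin k → Bool)}
    (hP : P.Solves fun x R => ∀ i j, R i j = true ↔ x i = x j) [Nonempty S]
    {correct : (Fin k → Fin n → Bool) → S → Prop} (hex : ∀ x, ∃ s, correct x s)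
    (hcongr : ∀ x y s, (∀ i j, x i = x j ↔ y i = y j) → correct x s → correct y s) :
    ∃ P' : QuantumSMP k n S, P'.Solves correct ∧ P'.cost = P.cost := by
  classical
  refine ⟨P.mapOutput fun R => Classical.epsilon fun s =>
    ∃ x : Fin k → Fin n → Bool, (∀ i j, R i j = true ↔ x i = x j) ∧ correct x s,
    hP.mapOutput _ fun x R hR => ?_, rfl⟩
  obtain ⟨s, hs⟩ := hex x
  obtain ⟨y, hy, hy'⟩ := Classical.epsilon_spec
    (p := fun s => ∃ x : Fin k → Fin n → Bool, (∀ i j, R i j = true ↔ x i = x j) ∧ correct x s)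
    ⟨s, x, hR, hs⟩
  exact hcongr y x _ (fun i j => by rw [← hy, hR]) hy'

theorem exists_equality_protocol_cost_le {n' : ℕ} (hk : 2 ≤ k) (hn : 2 ≤ n')
    (F : Fin k → Fin 2 → (Fin n → Bool) → Fin n' → Bool) :
    ∃ P : QuantumSMP k n ((Fin k × Fin 2) × (Fin k × Fin 2) → Bool),
      (P.cost : ℝ) ≤ 432 / Real.log 2 ^ 2 * (k * Real.log k * Real.log n') ∧
      P.Solves fun x R => ∀ u v, R (u, v) = true ↔ F u.1 u.2 (x u.1) = F v.1 v.2 (x v.1) := by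
  have hle : ∀ a, a ≤ 2 ^ Nat.clog 2 a := fun a => Nat.le_pow_clog (by norm_num) a
  -- The `1` in `s` pays for the factor `2` in `2 * n' ≤ 2 ^ s`, the `5` in `t` for `24 ≤ 2 ^ 5`.
  obtain ⟨P, hP, hP'⟩ := exists_equality_protocol (k := k) (s := 1 + Nat.clog 2 n')
    (t := 5 + 2 * Nat.clog 2 k) (by omega : 0 < n')
    (by rw [pow_add, pow_one]; exact Nat.mul_le_mul_left _ (hle _))
    (by
      rw [pow_add, mul_comm 2, pow_mul]
      exact Nat.mul_le_mul (by norm_num) (Nat.pow_le_pow_left (hle _) 2)) F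
  refine ⟨P, ?_, hP'⟩
  have hlog : 0 < Real.log 2 := Real.log_pos (by norm_num)
  have hone : ∀ a : ℕ, 2 ≤ a → 1 ≤ Real.log a / Real.log 2 := fun a ha => by
    rw [one_le_div hlog]
    exact Real.log_le_log (by norm_num) (by exact_mod_cast ha)
  have h1 : (5 + 2 * Nat.clog 2 k : ℝ) ≤ 9 * (Real.log k / Real.log 2) := by
    linarith [Nat.clog_two_le_log hk, hone k hk]
  have h2 : (1 + Nat.clog 2 n' : ℝ) ≤ 3 * (Real.log n' / Real.log 2) := by
    linarith [Nat.clog_two_le_log hn, hone n' hn]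
  rw [hP]
  push_cast
  -- The constant is `16 * 9 * 3 = 432`.
  calc (k : ℝ) * (4 * (5 + 2 * Nat.clog 2 k) * (2 * (2 * (1 + Nat.clog 2 n'))))
      = 16 * k * ((5 + 2 * Nat.clog 2 k) * (1 + Nat.clog 2 n')) := by ring
    _ ≤ 16 * k * (9 * (Real.log k / Real.log 2) * (3 * (Real.log n' / Real.log 2))) := by
      gcongr
    _ = _ := by
      field_simp
      ring

theorem exists_group_protocol (hn : 2 ≤ n) :
    ∃ P : QuantumSMP k n (Fin k → Fin k → Bool),
      (P.cost : ℝ) ≤ 432 / Real.log 2 ^ 2 * (k * Real.log k * Real.log n) ∧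
      P.Solves fun x R => ∀ i j, R i j = true ↔ x i = x j := by
  rcases le_or_gt 2 k with hk | hk
  · obtain ⟨P, hP, hP'⟩ := exists_equality_protocol_cost_le (n := n) hk hn fun _ _ x => x
    exact ⟨P.mapOutput fun R i j => R ((i, 0), (j, 0)), hP,
      hP'.mapOutput _ fun x R hR i j => hR (i, 0) (j, 0)⟩
  -- For `k ≤ 1` the cost bound is `0`, so nothing may be sent; all inputs are trivially equal.
  · have : Subsingleton (Fin k) := Fin.subsingleton_iff_le_one.2 (by omega)
    obtain ⟨P, hP, hP'⟩ := exists_cost_eq_zero (k := k) (n := n) fun _ _ : Fin k => true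
    refine ⟨P, ?_, fun x => hP' x _ fun i j => by simp [Subsingleton.elim i j]⟩
    rw [hP, Nat.cast_zero]
    exact mul_nonneg (by positivity)
      (mul_nonneg (mul_nonneg (Nat.cast_nonneg _) (Real.log_natCast_nonneg _))
        (Real.log_natCast_nonneg _))

theorem exists_inducedP3_protocol (k : ℕ) :
    ∃ P : QuantumSMP k k Bool, P.SolvesNIH IsInducedP3Answer ∧
      (P.cost : ℝ) ≤ 432 / Real.log 2 ^ 2 * (k * Real.log k ^ 2) := by
  classical
  rcases le_or_gt 2 k with hk | hk
  · let N : Fin k → (Fin k → Bool) → Finset (Fin k) := fun v x => {u | u = v ∨ x u = true}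
    have hN : ∀ v x, (N v x).Nonempty := fun v x => ⟨v, by simp [N]⟩
    let m : Fin k → (Fin k → Bool) → Fin k := fun v x => (N v x).min' (hN v x)
    obtain ⟨P, hP, hP'⟩ := exists_equality_protocol_cost_le (n := k) hk hk
      -- String `0` is the indicator of the closed neighborhood, string `1` that of its least
      -- element, so equality of strings `1` means equal minima.
      fun v j x u => if j = 0 then decide (u ∈ N v x) else decide (u = m v x)
    refine ⟨P.mapOutput fun R =>
      !decide (∀ u v, R ((u, 1), (v, 1)) = true → R ((u, 0), (v, 0)) = true), fun G => ?_, ?_⟩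
    · refine (hP' _).trans (prob_le_prob_mapOutput _ _ _ fun R hR => ?_)
      have hmemN : ∀ v u, u ∈ N v (neighborhoodVector G v) ↔ u = v ∨ G.Adj v u := by
        intro v u
        simp [N, neighborhoodVector]
      have h1 := not_exists_induced_path_iff G (fun v => m v (neighborhoodVector G v))
        (fun v => (hmemN v _).1 (Finset.min'_mem _ _))
        (fun v u hu => Finset.min'_le _ _ ((hmemN v u).2 hu))
      have h2 : ∀ u v, R ((u, 1), (v, 1)) = true ↔
          m u (neighborhoodVector G u) = m v (neighborhoodVector G v) := by
        intro u v
        rw [hR]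
        simp only [one_ne_zero, if_false, funext_iff, decide_eq_decide]
        exact ⟨fun h => (h _).1 rfl, fun h w => by rw [h]⟩
      have h3 : ∀ u v, R ((u, 0), (v, 0)) = true ↔
          ∀ w, (w = u ∨ G.Adj u w) ↔ (w = v ∨ G.Adj v w) := by
        intro u v
        rw [hR]
        simp only [if_true, funext_iff, decide_eq_decide, hmemN]
      rw [IsInducedP3Answer, nonempty_pathGraph_three_embedding_iff, ← not_iff_not, h1]
      simp only [h2, h3, Bool.not_eq_true', decide_eq_false_iff_not, not_not]
    · calc _ ≤ _ := hP
        _ = _ := by ring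
  · have : Subsingleton (Fin k) := Fin.subsingleton_iff_le_one.2 (by omega)
    obtain ⟨P, hP, hP'⟩ := exists_cost_eq_zero (k := k) (n := k) false
    refine ⟨P, fun G => hP' _ _ ?_, ?_⟩
    · rw [IsInducedP3Answer, nonempty_pathGraph_three_embedding_iff]
      simp only [Bool.false_eq_true, false_iff]
      rintro ⟨a, b, c, -, -, hac, -⟩
      exact hac (Subsingleton.elim _ _)
    · rw [hP, Nat.cast_zero]
      positivity

end QuantumSMP

theorem mainTheorem5 :
    ∃ C : ℝ, 0 < C ∧
      (∀ k n : ℕ, 2 ≤ n →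
        (∃ P : QuantumSMP k n (Finpartition (Finset.univ : Finset (Fin k))),
          P.Solves IsGroupByEQ ∧ (P.cost : ℝ) ≤ C * (k * Real.log k * Real.log n)) ∧
        (∃ P : QuantumSMP k n Bool,
          P.Solves IsAllEQ ∧ (P.cost : ℝ) ≤ C * (k * Real.log k * Real.log n)) ∧
        (∃ P : QuantumSMP k n Bool,
          P.Solves IsExistsEQ ∧ (P.cost : ℝ) ≤ C * (k * Real.log k * Real.log n)) ∧
        (∀ p : ℝ, 0 ≤ p →
          ∃ P : QuantumSMP k n ℝ,
            P.Solves (fun x s => s = frequencyMoment p x) ∧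
              (P.cost : ℝ) ≤ C * (k * Real.log k * Real.log n))) ∧
      (∀ k : ℕ,
        ∃ P : QuantumSMP k k Bool,
          P.SolvesNIH IsInducedP3Answer ∧ (P.cost : ℝ) ≤ C * (k * Real.log k ^ 2)) := by
  classical
  have hlog : 0 < Real.log 2 := Real.log_pos (by norm_num)
  refine ⟨432 / Real.log 2 ^ 2, by positivity, fun k n hn => ?_,
    QuantumSMP.exists_inducedP3_protocol⟩
  obtain ⟨P, hcost, hP⟩ := QuantumSMP.exists_group_protocol (k := k) hn
  refine ⟨?_, ?_, ?_, fun p _ => ?_⟩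
  · obtain ⟨P', h, h'⟩ := hP.exists_of_congr exists_isGroupByEQ fun x y Q h hQ i j => by
      rw [hQ i j, h]
    exact ⟨P', h, h' ▸ hcost⟩
  · obtain ⟨P', h, h'⟩ := hP.exists_of_congr (correct := IsAllEQ)
      (fun x => ⟨decide (∀ i j, x i = x j), by simp [IsAllEQ]⟩)
      fun x y b h hb => by simpa only [IsAllEQ, h] using hb
    exact ⟨P', h, h' ▸ hcost⟩
  · obtain ⟨P', h, h'⟩ := hP.exists_of_congr (correct := IsExistsEQ)
      (fun x => ⟨decide (∃ i j, i ≠ j ∧ x i = x j), by simp [IsExistsEQ]⟩)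
      fun x y b h hb => by simpa only [IsExistsEQ, h] using hb
    exact ⟨P', h, h' ▸ hcost⟩
  · obtain ⟨P', h, h'⟩ := hP.exists_of_congr (correct := fun x s => s = frequencyMoment p x)
      (fun x => ⟨_, rfl⟩) fun x y s h hs => hs.trans (frequencyMoment_congr p h)
    exact ⟨P', h, h' ▸ hcost⟩
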